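/- A linear group is a group isomorphic to a subgroup of $\mathrm{GL}_n(F)$ for some $n\in\mathbb N$ and some field $F$. A pseudofinite group is an infinite group that satisfies every first-order sentence, in the language of groups, that holds in all finite groups. For a prime $p$, a $p$-subgroup of a group is a subgroup in which every element has order a power of $p$, and a Sylow $p$-subgroup is a $p$-subgroup that is maximal with respect to inclusion. **Theorem.** Let $G$ be a linear pseudofinite group and let $p$ be a prime number. If $G$ has a finite Sylow $p$-subgroup, then every Sylow $p$-subgroup of $G$ is finite, and any two Sylow $p$-subgroups of $G$ are conjugate in $G$. -/

import Mathlib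

/-- The function symbols of the language of groups: a binary symbol for multiplication, a unary
symbol for inversion and a constant symbol for the identity. -/
inductive GroupFunc : ℕ → Type
  | mul : GroupFunc 2
  | inv : GroupFunc 1
  | one : GroupFunc 0

/-- The first-order language of groups `(·, ⁻¹, 1)`. -/
def groupLanguage : FirstOrder.Language where
  Functions := GroupFunc
  Relations := fun _ => Empty

/-- Every group is a structure for the language of groups, with the intended interpretation of the
symbols. -/
instance groupStructure (G : Type*) [Group G] : groupLanguage.Structure G where
  funMap := fun {n} f =>
    match n, f with
    | _, GroupFunc.mul => fun x => x 0 * x 1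
    | _, GroupFunc.inv => fun x => (x 0)⁻¹
    | _, GroupFunc.one => fun _ => 1
  RelMap := fun {_} r => r.elim

/-- The common theory of finite groups: all first-order sentences of the language of groups that
hold in every finite group. (Every finite group is isomorphic to one whose underlying type lives in
`Type`, so it is enough to let `H` range over `Type`.) -/
def finiteGroupTheory : groupLanguage.Theory :=
  {φ | ∀ (H : Type) [Group H] [Finite H], FirstOrder.Language.Sentence.Realize H φ}

/-- A pseudofinite group is an infinite group that is a model of the common theory of finite
groups. -/
def IsPseudofiniteGroup (G : Type*) [Group G] : Prop :=
  Infinite G ∧ finiteGroupTheory.Model G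

universe u v

/-- A linear group is a group isomorphic to a subgroup of `GL_n(F)` for some `n` and some
field `F`. -/
def IsLinearGroup (G : Type u) [Group G] : Prop :=
  ∃ (n : ℕ) (F : Type v) (_ : Field F) (H : Subgroup (Matrix.GeneralLinearGroup (Fin n) F)),
    Nonempty (G ≃* H)

/-!
Let `P₀` be a finite Sylow `p`-subgroup of `G`, of order `p ^ a`. By maximality `P₀` lies in no
subgroup of order `p ^ (a + 1)`. For finite groups, a subgroup of order `p ^ a` with that property
is a Sylow subgroup, so each subgroup of order `p ^ b` has a conjugate inside it. For fixed `a` and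
`b` this is a first-order sentence (`groupLanguage.conjSentence`), with subgroups of fixed finite
order represented by tuples listing their elements. Hence it holds in `G`, and every finite
`p`-subgroup of `G` is conjugate into `P₀` (`IsPseudofiniteGroup.exists_map_conj_le`).

It remains to see that an arbitrary `p`-subgroup `Q` of `G` is finite; this is where linearity
enters. Finite cyclic subgroups of `Q` are conjugate into `P₀`, so `Q` has bounded exponent. By
Burnside, a finitely generated linear group of bounded exponent is finite
(`Representation.finite_range_of_fg_of_pow_eq_one`): an irreducible representation is determined by
finitely many traces, which are sums of roots of unity; in the reducible case, one inducts on the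
dimension, as the kernel of the action on a subrepresentation and its quotient acts through an
abelian group. Therefore every finite subset of `Q` generates a finite `p`-group, of order at most
`|P₀|`, and so `Q` is finite.
-/

/-! ### Linear groups of bounded exponent -/

/-- The trace form on `End V` is nondegenerate, in every characteristic. -/
theorem Module.End.ext_trace_mul {K V : Type*} [Field K] [AddCommGroup V] [Module K V]
    [FiniteDimensional K V] {f g : Module.End K V}
    (h : ∀ u : Module.End K V, LinearMap.trace K V (u * f) = LinearMap.trace K V (u * g)) :
    f = g := by
  let b := Module.finBasis K V
  apply (LinearMap.toMatrix b b).injective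
  refine Matrix.ext_iff_trace_mul_left.2 fun A ↦ ?_
  have := h (Matrix.toLin b b A)
  simpa [LinearMap.trace_eq_matrix_trace K b, LinearMap.toMatrix_mul] using this

theorem Module.End.finite_trace_of_pow_eq_one (K V : Type*) [Field K] [IsAlgClosed K]
    [AddCommGroup V] [Module K V] [FiniteDimensional K V] {e : ℕ} (he : 0 < e) :
    {t : K | ∃ f : Module.End K V, f ^ e = 1 ∧ LinearMap.trace K V f = t}.Finite := by
  classical
  -- The trace is the sum of the roots of the characteristic polynomial, a multiset of fixed size
  -- of `e`-th roots of unity.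
  set R : Set K := {c | c ^ e = 1}
  have hR : R.Finite := by
    refine (Polynomial.finite_setOfPred_isRoot
      (Polynomial.X_pow_sub_C_ne_zero he (1 : K))).subset fun c hc ↦ ?_
    have hc : c ^ e = 1 := hc
    simp [hc]
  have : Finite R := hR
  refine (Set.finite_range fun s : Sym R (Module.finrank K V) ↦
    ((s : Multiset R).map Subtype.val).sum).subset ?_
  rintro t ⟨f, hf, rfl⟩
  have hroots : ∀ c ∈ f.charpoly.roots, c ∈ R := by
    intro c hc
    have hc' : f.HasEigenvalue c :=
      (Module.End.hasEigenvalue_iff_isRoot_charpoly f c).2 (Polynomial.isRoot_of_mem_roots hc)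
    obtain ⟨v, hv⟩ := hc'.exists_hasEigenvector
    have h1 := hv.pow_apply e
    rw [hf] at h1
    have h2 : (c ^ e - 1) • v = 0 := by
      rw [sub_smul, ← h1]; simp
    rcases smul_eq_zero.1 h2 with h | h
    · exact sub_eq_zero.1 h
    · exact absurd h hv.2
  refine ⟨⟨f.charpoly.roots.attach.map fun c ↦ ⟨c.1, hroots _ c.2⟩, ?_⟩, ?_⟩
  · rw [Multiset.card_map, Multiset.card_attach, ← (IsAlgClosed.splits _).natDegree_eq_card_roots,
      LinearMap.charpoly_natDegree]
  · simp only [Sym.coe_mk, Multiset.map_map, Function.comp_def]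
    rw [Multiset.attach_map_val,
      Module.End.trace_eq_sum_roots_charpoly_of_splits (IsAlgClosed.splits _)]

namespace Representation

variable {K G V : Type*} [Field K] [Group G] [AddCommGroup V] [Module K V]

/-- Burnside's theorem on matrix algebras: over an algebraically closed field, the operators of an
irreducible finite-dimensional representation span all endomorphisms. By Schur's lemma every
linear map commutes with the intertwiners, so this is the density theorem applied to a basis. -/
theorem span_range_eq_top_of_isIrreducible [IsAlgClosed K] [FiniteDimensional K V]
    (ρ : Representation K G V) [ρ.IsIrreducible] :
    Submodule.span K (Set.range ρ) = ⊤ := by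
  classical
  refine eq_top_iff.2 fun f _ ↦ ?_
  let A := MonoidAlgebra K G
  have hsc := (IsSimpleModule.algebraMap_end_bijective_of_isAlgClosed (A := A)
    (V := ρ.asModule) K).2
  let F : Module.End (Module.End A ρ.asModule) ρ.asModule :=
    { toFun := fun v ↦ ρ.asModuleEquiv.symm (f (ρ.asModuleEquiv v))
      map_add' := by simp
      map_smul' := by
        intro u v
        obtain ⟨c, rfl⟩ := hsc u
        change ρ.asModuleEquiv.symm (f (ρ.asModuleEquiv (c • v))) = c • _
        simp }
  let b := Module.finBasis K V
  obtain ⟨r, hr⟩ := jacobson_density F (Finset.univ.image fun i ↦ ρ.asModuleEquiv.symm (b i))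
  have hf : f = ρ.asAlgebraHom r := by
    refine b.ext fun i ↦ ?_
    have h1 := congrArg ρ.asModuleEquiv
      (hr (ρ.asModuleEquiv.symm (b i)) (Finset.mem_image_of_mem _ (Finset.mem_univ i)))
    rw [asModuleEquiv_map_smul] at h1
    simpa [F] using h1
  rw [hf]
  clear hr hf
  induction r using MonoidAlgebra.induction_linear with
  | zero => simp
  | add x y hx hy => rw [map_add]; exact add_mem hx hy
  | single g c =>
    rw [asAlgebraHom_single]
    exact Submodule.smul_mem _ _ (Submodule.subset_span ⟨g, rfl⟩)

/-- An operator `ρ g` is determined by the traces of its products with a finite spanning set of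
operators of the representation, and these traces take finitely many values. -/
theorem finite_range_of_isIrreducible [IsAlgClosed K] [FiniteDimensional K V]
    (ρ : Representation K G V) [ρ.IsIrreducible] {e : ℕ} (he : 0 < e) (hρ : ∀ g, ρ g ^ e = 1) :
    (Set.range ρ).Finite := by
  obtain ⟨s, hs, -, hspan, -⟩ := Submodule.exists_finset_span_eq_linearIndepOn K (Set.range ρ)
  rw [span_range_eq_top_of_isIrreducible] at hspan
  set T := {t : K | ∃ f : Module.End K V, f ^ e = 1 ∧ LinearMap.trace K V f = t}
  have hT : Finite T := Module.End.finite_trace_of_pow_eq_one K V he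
  let τ : Set.range ρ → (s → T) := fun f i ↦
    ⟨LinearMap.trace K V (i * f), by
      obtain ⟨g, hg⟩ := f.2
      obtain ⟨h, hh⟩ := hs i.2
      exact ⟨i * f, by rw [← hg, ← hh, ← map_mul, hρ], rfl⟩⟩
  refine Set.finite_coe_iff.1 <| Finite.of_injective τ fun f g hfg ↦
    Subtype.ext (Module.End.ext_trace_mul fun u ↦ ?_)
  have hu : u ∈ Submodule.span K (s : Set (Module.End K V)) := hspan ▸ Submodule.mem_top
  induction hu using Submodule.span_induction with
  | mem x hx => exact congrArg Subtype.val (congrFun hfg ⟨x, hx⟩)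
  | zero => simp
  | add x y _ _ hx hy => simp [add_mul, hx, hy]
  | smul c x _ hx => simp [hx]

/-- The elements acting trivially on a subrepresentation and on its quotient form a subgroup of
finite index, hence a finitely generated one. It acts through commuting operators, that is, through
a finitely generated torsion abelian group. -/
theorem finite_range_of_subrepresentation [Group.FG G] (ρ : Representation K G V)
    (σ : Subrepresentation ρ) {e : ℕ} (he : 0 < e) (hρ : ∀ g, ρ g ^ e = 1)
    (h1 : (Set.range σ.toRepresentation).Finite)
    (h2 : (Set.range (ρ.quotient σ.toSubmodule σ.apply_mem_toSubmodule)).Finite) :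
    (Set.range ρ).Finite := by
  let θ : G →* Module.End K σ.toSubmodule × Module.End K (V ⧸ σ.toSubmodule) :=
    MonoidHom.prod σ.toRepresentation (ρ.quotient σ.toSubmodule σ.apply_mem_toSubmodule)
  set N := θ.toHomUnits.ker
  have hN : N.FiniteIndex := by
    have : Finite θ.toHomUnits.range := by
      refine Set.Finite.of_finite_image (f := Units.val) ?_ Units.val_injective.injOn
      refine (h1.prod h2).subset ?_
      rintro _ ⟨_, ⟨g, rfl⟩, rfl⟩
      exact ⟨⟨g, rfl⟩, ⟨g, rfl⟩⟩
    infer_instance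
  have hNmem : ∀ n ∈ N, (∀ v, ρ n v - v ∈ σ.toSubmodule) ∧ ∀ w ∈ σ.toSubmodule, ρ n w = w := by
    intro n hn
    have h : θ n = 1 := congrArg Units.val hn
    refine ⟨fun v ↦ ?_, fun w hw ↦ ?_⟩
    · have := LinearMap.congr_fun (congrArg Prod.snd h) (Submodule.Quotient.mk v)
      exact (Submodule.Quotient.eq _).1 this
    · have := LinearMap.congr_fun (congrArg Prod.fst h) ⟨w, hw⟩
      exact congrArg Subtype.val this
  have hcomm : ∀ m ∈ N, ∀ n ∈ N, ρ m * ρ n = ρ n * ρ m := by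
    -- For `m`, `n` in `N` the product `(ρ m - 1) * (ρ n - 1)` vanishes.
    have key : ∀ m ∈ N, ∀ n ∈ N, ∀ v, ρ m (ρ n v) = ρ n v + ρ m v - v := by
      intro m hm n hn v
      have := (hNmem m hm).2 _ ((hNmem n hn).1 v)
      rw [map_sub] at this
      rw [sub_eq_iff_eq_add.1 this]
      abel
    intro m hm n hn
    ext v
    simp only [Module.End.mul_apply, key m hm n hn, key n hn m hm]
    abel
  let f : N →* (Module.End K V)ˣ := (MonoidHom.toHomUnits ρ).comp N.subtype
  have hf : Finite f.range := by
    let : CommGroup f.range :=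
      { (inferInstance : Group f.range) with
        mul_comm := by
          rintro ⟨_, m, rfl⟩ ⟨_, n, rfl⟩
          exact Subtype.ext (Units.ext (hcomm m m.2 n n.2)) }
    have : Group.FG N := N.fg_of_index_ne_zero
    have : Group.FG f.range := inferInstance
    refine @CommGroup.finite_of_fg_isMulTorsion f.range _ this ?_
    rintro ⟨_, m, rfl⟩
    refine isOfFinOrder_iff_pow_eq_one.2 ⟨e, he, Subtype.ext (Units.ext ?_)⟩
    exact hρ m
  have hf' : (ρ '' N).Finite := by
    have : (Units.val '' (f.range : Set (Module.End K V)ˣ)).Finite := Set.Finite.image _ hf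
    refine this.subset ?_
    rintro _ ⟨n, hn, rfl⟩
    exact ⟨f ⟨n, hn⟩, ⟨_, rfl⟩, rfl⟩
  refine ((Set.finite_range fun q : G ⧸ N ↦ ρ q.out).mul hf').subset ?_
  rintro _ ⟨g, rfl⟩
  refine ⟨_, ⟨(g : G ⧸ N), rfl⟩, _, ⟨(g : G ⧸ N).out⁻¹ * g, ?_, rfl⟩, ?_⟩
  · exact QuotientGroup.eq.1 (QuotientGroup.out_eq' _)
  · simp [← map_mul]

/-- Burnside's theorem that a finitely generated linear group of bounded exponent is finite, for
representations over an algebraically closed field. -/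
theorem finite_range_of_fg_of_pow_eq_one [Group.FG G] [IsAlgClosed K] [FiniteDimensional K V]
    (ρ : Representation K G V) {e : ℕ} (he : 0 < e) (hρ : ∀ g, ρ g ^ e = 1) :
    (Set.range ρ).Finite := by
  induction hd : Module.finrank K V using Nat.strong_induction_on generalizing V with
  | _ d ih =>
    subst hd
    rcases subsingleton_or_nontrivial V with hV | hV
    · exact Set.toFinite _
    by_cases hirr : ρ.IsIrreducible
    · exact finite_range_of_isIrreducible ρ he hρ
    obtain ⟨σ, hbot, htop⟩ : ∃ σ : Subrepresentation ρ, σ ≠ ⊥ ∧ σ ≠ ⊤ := by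
      by_contra! h
      refine hirr { exists_pair_ne := ⟨⊥, ⊤, fun hbt ↦ ?_⟩, eq_bot_or_eq_top := fun σ ↦ ?_ }
      · exact bot_ne_top (congrArg Subrepresentation.toSubmodule hbt : (⊥ : Submodule K V) = ⊤)
      · exact or_iff_not_imp_left.2 (h σ)
    have hbot' : σ.toSubmodule ≠ ⊥ := fun h ↦ hbot (Subrepresentation.toSubmodule_injective h)
    have htop' : σ.toSubmodule ≠ ⊤ := fun h ↦ htop (Subrepresentation.toSubmodule_injective h)
    have hpow1 : ∀ g, σ.toRepresentation g ^ e = 1 := fun g ↦ by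
      rw [← map_pow]
      ext v
      change ρ (g ^ e) v = v
      simp [map_pow, hρ]
    have hpow2 : ∀ g, (ρ.quotient σ.toSubmodule σ.apply_mem_toSubmodule) g ^ e = 1 := fun g ↦ by
      rw [← map_pow]
      ext v
      change Submodule.Quotient.mk (ρ (g ^ e) v) = Submodule.Quotient.mk v
      simp [map_pow, hρ]
    have hquot : Module.finrank K (V ⧸ σ.toSubmodule) < Module.finrank K V := by
      have := σ.toSubmodule.finrank_quotient_add_finrank
      have := Submodule.one_le_finrank_iff.2 hbot'
      omega
    exact finite_range_of_subrepresentation ρ σ he hρ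
      (ih _ (Submodule.finrank_lt htop') _ hpow1 rfl)
      (ih _ hquot _ hpow2 rfl)

end Representation

/-- Burnside's theorem over an arbitrary field, by extension of scalars to the algebraic closure. -/
theorem Group.finite_of_fg_of_pow_eq_one_of_injective {G : Type*} [Group G] [Group.FG G]
    {n : ℕ} {F : Type*} [Field F] (φ : G →* Matrix.GeneralLinearGroup (Fin n) F)
    (hφ : Function.Injective φ) {e : ℕ} (he : 0 < e) (hG : ∀ g : G, g ^ e = 1) : Finite G := by
  let K := AlgebraicClosure F
  let ρ : Representation K G (Fin n → K) :=
    ((Matrix.toLinAlgEquiv' : Matrix (Fin n) (Fin n) K ≃ₐ[K] _).toRingEquiv.toRingHom.comp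
      (algebraMap F K).mapMatrix).toMonoidHom.comp ((Units.coeHom _).comp φ)
  have hρ : Function.Injective ρ := by
    intro g h hgh
    apply hφ
    apply Units.ext
    apply Matrix.map_injective (algebraMap F K).injective
    exact Matrix.toLinAlgEquiv'.injective hgh
  have : Finite (Set.range ρ) := ρ.finite_range_of_fg_of_pow_eq_one he fun g ↦ by
    rw [← map_pow, hG, map_one]
  exact Finite.of_injective (Set.rangeFactorization ρ)
    (Set.rangeFactorization_injective.2 hρ)

/-! ### First-order expression of conjugacy of finite `p`-subgroups -/

section

open FirstOrder FirstOrder.Language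

/-- A tuple enumerates a subgroup if it is injective and its set of values is closed under
multiplication; for a nonempty finite tuple in a group this does make the set of values a
subgroup. -/
def EnumeratesSubgroup {ι G : Type*} [Group G] (x : ι → G) : Prop :=
  Function.Injective x ∧ ∀ i j, ∃ k, x i * x j = x k

theorem EnumeratesSubgroup.exists_subgroup {ι G : Type*} [Finite ι] [Nonempty ι] [Group G]
    {x : ι → G} (hx : EnumeratesSubgroup x) :
    ∃ H : Subgroup G, (H : Set G) = Set.range x ∧ Nat.card H = Nat.card ι := by
  -- Left multiplication by `x i` permutes the finite set of values.
  have hsurj (i : ι) (k : ι) : ∃ j, x i * x j = x k := by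
    choose m hm using hx.2
    have hinj : Function.Injective (m i) := fun a b hab ↦ hx.1 <| by
      have : x i * x a = x i * x b := by rw [hm, hm, hab]
      exact mul_left_cancel this
    obtain ⟨j, hj⟩ := Finite.surjective_of_injective hinj k
    exact ⟨j, by rw [hm, hj]⟩
  have hone : (1 : G) ∈ Set.range x := by
    obtain ⟨i⟩ := ‹Nonempty ι›
    obtain ⟨j, hj⟩ := hsurj i i
    exact ⟨j, mul_eq_left.1 hj⟩
  refine ⟨{ carrier := Set.range x, mul_mem' := ?_, one_mem' := hone, inv_mem' := ?_ }, rfl, ?_⟩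
  · rintro _ _ ⟨i, rfl⟩ ⟨j, rfl⟩
    obtain ⟨k, hk⟩ := hx.2 i j
    exact ⟨k, hk.symm⟩
  · rintro _ ⟨i, rfl⟩
    obtain ⟨k, hk⟩ := hone
    obtain ⟨j, hj⟩ := hsurj i k
    exact ⟨j, eq_inv_of_mul_eq_one_right (hj.trans hk)⟩
  · exact Nat.card_range_of_injective hx.1

theorem Subgroup.exists_enumeratesSubgroup {G : Type*} [Group G] (H : Subgroup G) [Finite H]
    {n : ℕ} (hn : Nat.card H = n) :
    ∃ x : Fin n → G, EnumeratesSubgroup x ∧ Set.range x = H := by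
  let e := (Finite.equivFinOfCardEq hn).symm
  refine ⟨fun i ↦ e i, ⟨Subtype.val_injective.comp e.injective, fun i j ↦
    ⟨e.symm (e i * e j), by simp⟩⟩, ?_⟩
  ext g
  exact ⟨by rintro ⟨i, rfl⟩; exact (e i).2, fun hg ↦ ⟨e.symm ⟨g, hg⟩, by simp⟩⟩

namespace groupLanguage

/-- The term `s * t`. -/
def mulTerm {α : Type*} (s t : groupLanguage.Term α) : groupLanguage.Term α :=
  Term.func (GroupFunc.mul : groupLanguage.Functions 2) ![s, t]

@[simp]
theorem realize_mulTerm {α G : Type*} [Group G] (s t : groupLanguage.Term α) (v : α → G) :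
    (mulTerm s t).realize v = s.realize v * t.realize v := rfl

/-- The formula saying that the variables `v i` enumerate a subgroup. -/
noncomputable def enumFormula {ι α : Type*} [Finite ι] (v : ι → α) : groupLanguage.Formula α :=
  (Formula.iInf fun q : {q : ι × ι // q.1 ≠ q.2} ↦
      ((Term.var (v q.1.1)).equal (Term.var (v q.1.2))).not) ⊓
    Formula.iInf fun q : ι × ι ↦ Formula.iSup fun k : ι ↦
      (mulTerm (Term.var (v q.1)) (Term.var (v q.2))).equal (Term.var (v k))

@[simp]
theorem realize_enumFormula {ι α G : Type*} [Finite ι] [Group G] (v : ι → α) (x : α → G) :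
    (enumFormula v).Realize x ↔ EnumeratesSubgroup fun i ↦ x (v i) := by
  simp only [enumFormula, Formula.realize_inf, Formula.realize_iInf, Formula.realize_iSup,
    Formula.realize_not, Formula.realize_equal, realize_mulTerm, Term.realize_var,
    EnumeratesSubgroup, Prod.forall, Subtype.forall]
  refine and_congr_left fun _ ↦ ⟨fun h i j hij ↦ ?_, fun h i j hne hij ↦ hne (h hij)⟩
  by_contra hne
  exact h i j hne hij

/-- The sentence saying: if `x` enumerates a subgroup of order `m` that is not contained in a
subgroup of order `l`, then every subgroup of order `n` is conjugate into `x`. -/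
noncomputable def conjSentence (m n l : ℕ) : groupLanguage.Sentence :=
  Formula.iAlls (Fin m ⊕ Fin n) <|
    (enumFormula (fun i : Fin m ↦ Sum.inr (Sum.inl i)) ⊓
      (enumFormula (fun j : Fin n ↦ Sum.inr (Sum.inr j)) ⊓
      (Formula.iExs (Fin l) (enumFormula (fun k : Fin l ↦ Sum.inr k) ⊓
        Formula.iInf fun i : Fin m ↦ Formula.iSup fun k : Fin l ↦
          (Term.var (Sum.inl (Sum.inr (Sum.inl i)))).equal (Term.var (Sum.inr k)))).not)).imp
    (Formula.iExs Unit <| Formula.iInf fun j : Fin n ↦ Formula.iSup fun i : Fin m ↦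
      (mulTerm (Term.var (Sum.inr ())) (Term.var (Sum.inl (Sum.inr (Sum.inr j))))).equal
        (mulTerm (Term.var (Sum.inl (Sum.inr (Sum.inl i)))) (Term.var (Sum.inr ()))))

theorem realize_conjSentence {G : Type*} [Group G] (m n l : ℕ) :
    G ⊨ conjSentence m n l ↔ ∀ (x : Fin m → G) (y : Fin n → G),
      EnumeratesSubgroup x → EnumeratesSubgroup y →
      (¬ ∃ z : Fin l → G, EnumeratesSubgroup z ∧ ∀ i, ∃ k, x i = z k) →
      ∃ g : G, ∀ j, ∃ i, g * y j = x i * g := by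
  simp only [Sentence.Realize, conjSentence, Formula.realize_iAlls, Formula.realize_imp,
    Formula.realize_inf, realize_enumFormula, Formula.realize_not, Formula.realize_iExs,
    Formula.realize_iInf, Formula.realize_iSup, Formula.realize_equal, realize_mulTerm,
    Term.realize_var, Sum.elim_inl, Sum.elim_inr, and_imp]
  constructor
  · intro h x y hx hy hz
    obtain ⟨u, hu⟩ := h (Sum.elim x y) hx hy hz
    exact ⟨u (), hu⟩
  · intro h w hx hy hz
    obtain ⟨g, hg⟩ := h _ _ hx hy hz
    exact ⟨fun _ ↦ g, hg⟩

end groupLanguage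

/-- The statement carried by `conjSentence`, in terms of subgroups. -/
theorem groupLanguage.realize_conjSentence_iff_subgroup {G : Type*} [Group G] {m n l : ℕ}
    (hm : 0 < m) (hn : 0 < n) (hl : 0 < l) :
    G ⊨ conjSentence m n l ↔ ∀ P R : Subgroup G, Nat.card P = m → Nat.card R = n →
      (∀ S : Subgroup G, Nat.card S = l → ¬ P ≤ S) →
      ∃ g : G, R.map (MulAut.conj g).toMonoidHom ≤ P := by
  have : Nonempty (Fin m) := ⟨⟨0, hm⟩⟩
  have : Nonempty (Fin n) := ⟨⟨0, hn⟩⟩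
  have : Nonempty (Fin l) := ⟨⟨0, hl⟩⟩
  rw [realize_conjSentence]
  constructor
  · intro h P R hP hR hS
    have : Finite P := Nat.finite_of_card_ne_zero (by omega)
    have : Finite R := Nat.finite_of_card_ne_zero (by omega)
    obtain ⟨x, hx, hxP⟩ := P.exists_enumeratesSubgroup hP
    obtain ⟨y, hy, hyR⟩ := R.exists_enumeratesSubgroup hR
    obtain ⟨g, hg⟩ := h x y hx hy <| by
      rintro ⟨z, hz, hxz⟩
      obtain ⟨S, hSz, hcard⟩ := hz.exists_subgroup
      refine hS S (by simpa using hcard) fun a ha ↦ ?_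
      rw [← SetLike.mem_coe, ← hxP] at ha
      obtain ⟨i, rfl⟩ := ha
      rw [← SetLike.mem_coe, hSz]
      obtain ⟨k, hk⟩ := hxz i
      exact ⟨k, hk.symm⟩
    refine ⟨g, ?_⟩
    rintro _ ⟨a, ha, rfl⟩
    rw [← hyR] at ha
    obtain ⟨j, rfl⟩ := ha
    obtain ⟨i, hi⟩ := hg j
    rw [← SetLike.mem_coe, ← hxP]
    exact ⟨i, by simp [hi]⟩
  · intro h x y hx hy hz
    obtain ⟨P, hPx, hP⟩ := hx.exists_subgroup
    obtain ⟨R, hRy, hR⟩ := hy.exists_subgroup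
    obtain ⟨g, hg⟩ := h P R (by simpa using hP) (by simpa using hR) <| by
      intro S hS hPS
      have : Finite S := Nat.finite_of_card_ne_zero (by omega)
      obtain ⟨z, hz', hzS⟩ := S.exists_enumeratesSubgroup hS
      refine hz ⟨z, hz', fun i ↦ ?_⟩
      have : x i ∈ Set.range z := hzS ▸ hPS (by rw [← SetLike.mem_coe, hPx]; exact ⟨i, rfl⟩)
      obtain ⟨k, hk⟩ := this
      exact ⟨k, hk.symm⟩
    refine ⟨g, fun j ↦ ?_⟩
    have : MulAut.conj g (y j) ∈ (P : Set G) :=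
      hg ⟨y j, by rw [hRy]; exact ⟨j, rfl⟩, rfl⟩
    rw [hPx] at this
    obtain ⟨i, hi⟩ := this
    exact ⟨i, by simp [hi]⟩

/-- In a finite group, a subgroup of order `p ^ a` contained in no subgroup of order `p ^ (a + 1)`
is a Sylow `p`-subgroup, so it contains a conjugate of every `p`-subgroup. -/
theorem Sylow.exists_map_conj_le_of_finite {H : Type*} [Group H] [Finite H] {p : ℕ}
    [Fact p.Prime] {P R : Subgroup H} {a : ℕ} (hP : Nat.card P = p ^ a) (hR : IsPGroup p R)
    (hmax : ∀ S : Subgroup H, Nat.card S = p ^ (a + 1) → ¬ P ≤ S) :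
    ∃ g : H, R.map (MulAut.conj g).toMonoidHom ≤ P := by
  obtain ⟨Q, hQ⟩ := (IsPGroup.of_card hP).exists_le_sylow
  obtain ⟨T, hT⟩ := hR.exists_le_sylow
  have hPQ : P = Q := by
    obtain ⟨b, hb⟩ := IsPGroup.iff_card.1 Q.2
    refine Subgroup.eq_of_le_of_card_ge hQ ?_
    have hba : b ≤ a := by
      by_contra! hab
      obtain ⟨S, hS, hPS⟩ := Sylow.exists_subgroup_card_pow_succ (p := p) (n := a)
        ((pow_dvd_pow p hab).trans (hb ▸ Q.1.card_subgroup_dvd_card)) hP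
      exact hmax S hS hPS
    rw [hP]
    exact hb.trans_le (Nat.pow_le_pow_right (Fact.out : p.Prime).pos hba)
  obtain ⟨g, hg⟩ := MulAction.exists_smul_eq H T Q
  refine ⟨g, (Subgroup.map_mono hT).trans ?_⟩
  rw [hPQ, ← hg]
  exact le_rfl

/-- In a pseudofinite group, a finite Sylow `p`-subgroup contains a conjugate of every finite
`p`-subgroup. -/
theorem IsPseudofiniteGroup.exists_map_conj_le {G : Type*} [Group G] (hG : IsPseudofiniteGroup G)
    {p : ℕ} (hp : p.Prime) (P : Sylow p G) [Finite P] (R : Subgroup G) [Finite R]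
    (hR : IsPGroup p R) : ∃ g : G, R.map (MulAut.conj g).toMonoidHom ≤ P := by
  have : Fact p.Prime := ⟨hp⟩
  obtain ⟨a, ha⟩ := IsPGroup.iff_card.1 P.2
  obtain ⟨b, hb⟩ := IsPGroup.iff_card.1 hR
  have hpos (k : ℕ) : 0 < p ^ k := pow_pos hp.pos k
  have hmem : groupLanguage.conjSentence (p ^ a) (p ^ b) (p ^ (a + 1)) ∈ finiteGroupTheory := by
    intro H _ _
    rw [groupLanguage.realize_conjSentence_iff_subgroup (hpos _) (hpos _) (hpos _)]
    intro P R hP hR hS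
    exact Sylow.exists_map_conj_le_of_finite hP (IsPGroup.of_card hR) hS
  have := hG.2.realize_of_mem _ hmem
  refine (groupLanguage.realize_conjSentence_iff_subgroup (hpos _) (hpos _) (hpos _)).1 this
    P R ha hb fun S hS hPS ↦ ?_
  have h := P.3 (IsPGroup.of_card hS) hPS
  rw [h, ha] at hS
  exact absurd hS (Nat.pow_lt_pow_succ hp.one_lt).ne

end

/-! ### Sylow subgroups of linear pseudofinite groups -/

/-- A subset of `Q` with `M + 1` elements would generate a finite subgroup, of order greater
than `M`. -/
theorem IsLinearGroup.finite_of_pow_eq_one_of_card_le {G : Type u} [Group G]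
    (hlin : IsLinearGroup.{u, v} G) (Q : Subgroup G) {e M : ℕ} (he : 0 < e)
    (hQ : ∀ g ∈ Q, g ^ e = 1) (hcard : ∀ R : Subgroup G, R ≤ Q → Finite R → Nat.card R ≤ M) :
    Finite Q := by
  obtain ⟨n, F, _, H, ⟨f⟩⟩ := hlin
  by_contra hinf
  have : Infinite Q := not_finite_iff_infinite.1 hinf
  obtain ⟨t, ht⟩ := Infinite.exists_subset_card_eq Q (M + 1)
  let S : Set G := Subtype.val '' (t : Set Q)
  let R := Subgroup.closure S
  have hS : S.Finite := t.finite_toSet.image _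
  have hRQ : R ≤ Q := (Subgroup.closure_le _).2 <| by rintro _ ⟨q, -, rfl⟩; exact q.2
  have : Finite S := hS
  have : Group.FG R := Group.closure_finite_fg S
  have hR : Finite R := Group.finite_of_fg_of_pow_eq_one_of_injective
    (H.subtype.comp (f.toMonoidHom.comp R.subtype))
    (H.subtype_injective.comp (f.injective.comp R.subtype_injective)) he
    fun g ↦ Subtype.ext (hQ g (hRQ g.2))
  have hle : S.ncard ≤ Nat.card R := by
    rw [← Nat.card_coe_set_eq]
    exact Nat.card_le_card_of_injective (Set.inclusion Subgroup.subset_closure)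
      (Set.inclusion_injective _)
  rw [Set.ncard_image_of_injective _ Subtype.val_injective, Set.ncard_coe_finset, ht] at hle
  exact absurd (hcard R hRQ hR) (by omega)

theorem theorem3p2 (G : Type u) [Group G]
    (hlin : IsLinearGroup.{u, v} G) (hpf : IsPseudofiniteGroup G)
    (p : ℕ) (hp : p.Prime)
    (hfin : ∃ P : Sylow p G, Finite P) :
    (∀ P : Sylow p G, Finite P) ∧
      ∀ P Q : Sylow p G, ∃ g : G,
        (P : Subgroup G).map (MulAut.conj g).toMonoidHom = (Q : Subgroup G) := by
  obtain ⟨P₀, hP₀⟩ := hfin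
  have hconj (R : Subgroup G) (hR : IsPGroup p R) (hRfin : Finite R) :
      ∃ g : G, R.map (MulAut.conj g).toMonoidHom ≤ P₀ := hpf.exists_map_conj_le hp P₀ R hR
  have hcard (R : Subgroup G) (hR : IsPGroup p R) (hRfin : Finite R) :
      Nat.card R ≤ Nat.card P₀ := by
    obtain ⟨g, hg⟩ := hconj R hR hRfin
    rw [← Subgroup.card_map_of_injective (f := (MulAut.conj g).toMonoidHom)
      (MulAut.conj g).injective]
    exact Subgroup.card_le_of_le hg
  -- The order of every `p`-element divides the order of `P₀`, as finite cyclic `p`-subgroups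
  -- are conjugate into `P₀`.
  have hpow (g : G) (k : ℕ) (hk : g ^ p ^ k = 1) : g ^ Nat.card P₀ = 1 := by
    have hfo : IsOfFinOrder g := isOfFinOrder_iff_pow_eq_one.2 ⟨_, pow_pos hp.pos k, hk⟩
    have : Finite (Subgroup.zpowers g) := hfo.finite_zpowers
    obtain ⟨c, hc⟩ := hconj (Subgroup.zpowers g) (fun ⟨x, hx⟩ ↦ by
      obtain ⟨i, rfl⟩ := Subgroup.mem_zpowers_iff.1 hx
      exact ⟨k, Subtype.ext (by
        change (g ^ i) ^ p ^ k = 1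
        rw [← zpow_natCast, zpow_comm, zpow_natCast, hk, one_zpow])⟩) this
    have hmem : MulAut.conj c g ∈ (P₀ : Subgroup G) :=
      hc ⟨g, Subgroup.mem_zpowers g, rfl⟩
    have h1 : (⟨_, hmem⟩ : (P₀ : Subgroup G)) ^ Nat.card P₀ = 1 := pow_card_eq_one'
    have h2 : MulAut.conj c g ^ Nat.card P₀ = 1 := congrArg Subtype.val h1
    rwa [← map_pow, EmbeddingLike.map_eq_one_iff] at h2
  have hall (Q : Sylow p G) : Finite Q := by
    refine hlin.finite_of_pow_eq_one_of_card_le Q (Nat.card_pos (α := P₀))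
      (fun g hg ↦ ?_) fun R hRQ hR ↦ hcard R (Q.2.to_le hRQ) hR
    obtain ⟨k, hk⟩ := Q.2 ⟨g, hg⟩
    exact hpow g k (congrArg Subtype.val hk)
  refine ⟨hall, fun P Q ↦ ?_⟩
  have hfinQ : Finite (Q : Subgroup G) := hall Q
  have hfinP : Finite (P : Subgroup G) := hall P
  -- Each of `P`, `Q` is conjugate into the other, and both are finite.
  obtain ⟨g, hg⟩ := hpf.exists_map_conj_le hp Q P P.2
  obtain ⟨h, hh⟩ := hpf.exists_map_conj_le hp P Q Q.2
  refine ⟨g, Subgroup.eq_of_le_of_card_ge hg ?_⟩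
  rw [Subgroup.card_map_of_injective (f := (MulAut.conj g).toMonoidHom) (MulAut.conj g).injective,
    ← Subgroup.card_map_of_injective (f := (MulAut.conj h).toMonoidHom)
      (K := (Q : Subgroup G)) (MulAut.conj h).injective]
  exact Subgroup.card_le_of_le hh
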